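/- Let $\mathbf p:\{0,1,2,\dots\}\to(0,\infty)$ satisfy $\lim_{k\to\infty}\mathbf p(k)^{1/k}=\infty$, and let $\mathcal A(\mathbf p)$ be the set of all entire functions $f(z)=\sum_{k=0}^\infty \widehat f(k)z^k$ with $\|f\|:=\sup_{k\ge 0}\mathbf p(k)|\widehat f(k)|<\infty$. With pointwise addition and scalar multiplication, the weighted Hadamard product $$(f*g)(z)=\sum_{k=0}^\infty \mathbf p(k)\,\widehat f(k)\,\widehat g(k)\,z^k ,$$ the norm $\|\cdot\|$ and the unit element $\varepsilon(z)=\sum_{k=0}^\infty \mathbf p(k)^{-1}z^k$, $\mathcal A(\mathbf p)$ is a commutative unital complex Banach algebra. Theorem. For every $n$ and every invertible matrix $A\in\mathrm{GL}_n(\mathcal A(\mathbf p))$ there exists a matrix $B\in\mathcal A(\mathbf p)^{n\times n}$ such that $e^B=A$, where $e^B=\sum_{m=0}^\infty \frac{1}{m!}B^m$ is the exponential in the matrix algebra $\mathcal A(\mathbf p)^{n\times n}$ (the products of entries being $*$). -/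

import Mathlib

open Filter Topology
open scoped Nat ENNReal

noncomputable section

namespace WeightedHadamard

/-- A weight: a sequence `p` of positive real numbers with `p(k)^(1/k) → ∞` as `k → ∞`. -/
structure Weight where
  toFun : ℕ → ℝ
  pos : ∀ k, 0 < toFun k
  tendsto_root : Tendsto (fun k : ℕ => toFun k ^ (1 / (k : ℝ))) atTop atTop

instance : CoeFun Weight (fun _ => ℕ → ℝ) := ⟨Weight.toFun⟩

/-- The `k`-th Taylor coefficient at `0` of a function `f : ℂ → ℂ`. -/
def taylorCoeff (f : ℂ → ℂ) (k : ℕ) : ℂ := ((k ! : ℕ) : ℂ)⁻¹ * iteratedDeriv k f 0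

/-- The functions `f : ℂ → ℂ` of the form `f(z) = ∑ aₖ zᵏ` with `p(k) |aₖ|` bounded in `k`;
this is a complex vector space under the pointwise operations. -/
def carrier (p : Weight) : Submodule ℂ (ℂ → ℂ) where
  carrier := {f | ∃ a : ℕ → ℂ, (∀ z, HasSum (fun k => a k * z ^ k) (f z)) ∧
    ∃ C : ℝ, ∀ k, p k * ‖a k‖ ≤ C}
  zero_mem' := ⟨0, fun z => by simp, 0, by simp⟩
  add_mem' := by
    rintro f g ⟨a, ha, C, hC⟩ ⟨b, hb, D, hD⟩
    refine ⟨a + b, fun z => by simpa [add_mul] using (ha z).add (hb z), C + D, fun k => ?_⟩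
    have h := mul_le_mul_of_nonneg_left (norm_add_le (a k) (b k)) (p.pos k).le
    have := hC k
    have := hD k
    simp only [Pi.add_apply]
    linarith
  smul_mem' := by
    rintro c f ⟨a, ha, C, hC⟩
    refine ⟨c • a, fun z => by simpa [mul_assoc] using (ha z).mul_left c, ‖c‖ * C, fun k => ?_⟩
    have h := mul_le_mul_of_nonneg_left (hC k) (norm_nonneg c)
    simp only [Pi.smul_apply, norm_smul]
    linarith

/-- The algebra `𝒜(p)` of entire functions. Its addition and scalar multiplication are pointwise;
its multiplication is the weighted Hadamard product (not the pointwise product) and its norm is the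
weighted supremum norm of the Taylor coefficients. -/
def EntireAlg (p : Weight) : Type := carrier p

namespace EntireAlg

variable {p : Weight}

instance : AddCommGroup (EntireAlg p) := inferInstanceAs (AddCommGroup (carrier p))
instance : Module ℂ (EntireAlg p) := inferInstanceAs (Module ℂ (carrier p))
instance : CoeFun (EntireAlg p) (fun _ => ℂ → ℂ) := ⟨fun f => f.1⟩

/-- The `k`-th Taylor coefficient of `f ∈ 𝒜(p)`. -/
def coeff (f : EntireAlg p) (k : ℕ) : ℂ := taylorCoeff f k

theorem taylorCoeff_eq {f : ℂ → ℂ} {a : ℕ → ℂ}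
    (h : ∀ z, HasSum (fun k => a k * z ^ k) (f z)) (k : ℕ) : taylorCoeff f k = a k := by
  have h1 : HasFPowerSeriesAt f (FormalMultilinearSeries.ofScalars ℂ a) 0 := by
    rw [hasFPowerSeriesAt_iff']
    refine Eventually.of_forall fun z => ?_
    simpa [FormalMultilinearSeries.coeff_ofScalars, mul_comm] using h z
  obtain ⟨r, hr⟩ := h1
  have h2 := hr.factorial_smul (1 : ℂ) k
  have h3 : iteratedDeriv k f 0 = (k ! : ℂ) * a k := by
    rw [iteratedDeriv_eq_iteratedFDeriv, ← h2]
    simp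
  rw [taylorCoeff, h3, inv_mul_cancel_left₀ (by exact_mod_cast k.factorial_ne_zero)]

theorem hasSum_coeff (f : EntireAlg p) (z : ℂ) :
    HasSum (fun k => f.coeff k * z ^ k) (f z) := by
  obtain ⟨a, ha, -⟩ := f.2
  have : f.coeff = a := funext fun k => taylorCoeff_eq ha k
  rw [this]
  exact ha z

theorem exists_bound (f : EntireAlg p) : ∃ C : ℝ, ∀ k, p k * ‖f.coeff k‖ ≤ C := by
  obtain ⟨a, ha, hC⟩ := f.2
  have : f.coeff = a := funext fun k => taylorCoeff_eq ha k
  rwa [this]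

theorem ext_coeff {f g : EntireAlg p} (h : ∀ k, f.coeff k = g.coeff k) : f = g := by
  refine Subtype.ext (funext fun z => ?_)
  have hf := f.hasSum_coeff z
  rw [funext h] at hf
  exact hf.unique (g.hasSum_coeff z)

theorem summable_of_bound (p : Weight) {a : ℕ → ℂ} {C : ℝ} (h : ∀ k, p k * ‖a k‖ ≤ C) (z : ℂ) :
    Summable (fun k => a k * z ^ k) := by
  have hC : 0 ≤ C := (mul_nonneg (p.pos 0).le (norm_nonneg _)).trans (h 0)
  refine Summable.of_norm_bounded_eventually_nat (g := fun k => C * (1 / 2 : ℝ) ^ k)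
    (summable_geometric_two.mul_left C) ?_
  filter_upwards [p.tendsto_root.eventually_ge_atTop (2 * ‖z‖), eventually_gt_atTop 0]
    with k hk hk0
  have h1 : (2 * ‖z‖) ^ k ≤ p k := by
    have := pow_le_pow_left₀ (by positivity) hk k
    rwa [← Real.rpow_natCast (p k ^ (1 / (k : ℝ))), ← Real.rpow_mul (p.pos k).le,
      one_div_mul_cancel (by exact_mod_cast hk0.ne'), Real.rpow_one] at this
  have h2 : (2 * ‖z‖) ^ k * ‖a k‖ ≤ C :=
    (mul_le_mul_of_nonneg_right h1 (norm_nonneg _)).trans (h k)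
  have h3 : ‖a k * z ^ k‖ = (2 * ‖z‖) ^ k * ‖a k‖ * (1 / 2 : ℝ) ^ k := by
    rw [norm_mul, norm_pow, mul_pow, one_div, inv_pow]
    field_simp
  rw [h3]
  exact mul_le_mul_of_nonneg_right h2 (by positivity)

/-- The element `z ↦ ∑ aₖ zᵏ` of `𝒜(p)`, for `p(k) |aₖ|` bounded. -/
def ofCoeff (a : ℕ → ℂ) (h : ∃ C : ℝ, ∀ k, p k * ‖a k‖ ≤ C) : EntireAlg p :=
  ⟨fun z => ∑' k, a k * z ^ k, a, fun z => (summable_of_bound p h.choose_spec z).hasSum, h⟩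

theorem coeff_ofCoeff (a : ℕ → ℂ) (h : ∃ C : ℝ, ∀ k, p k * ‖a k‖ ≤ C) (k : ℕ) :
    (ofCoeff a h).coeff k = a k :=
  taylorCoeff_eq (fun z => (summable_of_bound p h.choose_spec z).hasSum) k

theorem coeff_eq_of_hasSum (f : EntireAlg p) {a : ℕ → ℂ}
    (h : ∀ z, HasSum (fun k => a k * z ^ k) (f z)) (k : ℕ) : f.coeff k = a k :=
  taylorCoeff_eq h k

theorem coeff_zero (k : ℕ) : (0 : EntireAlg p).coeff k = 0 :=
  coeff_eq_of_hasSum 0 (a := fun _ => 0)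
    (fun z => by simp only [zero_mul]; exact hasSum_zero) k

theorem coeff_add (f g : EntireAlg p) (k : ℕ) : (f + g).coeff k = f.coeff k + g.coeff k :=
  coeff_eq_of_hasSum (f + g) (a := fun k => f.coeff k + g.coeff k)
    (fun z => by
      have := (f.hasSum_coeff z).add (g.hasSum_coeff z)
      simp only [← add_mul] at this
      exact this) k

theorem coeff_smul (c : ℂ) (f : EntireAlg p) (k : ℕ) : (c • f).coeff k = c * f.coeff k :=
  coeff_eq_of_hasSum (c • f) (a := fun k => c * f.coeff k)
    (fun z => by
      have := (f.hasSum_coeff z).mul_left c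
      simp only [← mul_assoc] at this
      exact this) k

theorem coeff_neg (f : EntireAlg p) (k : ℕ) : (-f).coeff k = -f.coeff k := by
  rw [← neg_one_smul ℂ f, coeff_smul, neg_one_mul]

theorem mul_bound (f g : EntireAlg p) :
    ∃ C : ℝ, ∀ k, p k * ‖(p k : ℂ) * f.coeff k * g.coeff k‖ ≤ C := by
  obtain ⟨C, hC⟩ := f.exists_bound
  obtain ⟨D, hD⟩ := g.exists_bound
  refine ⟨C * D, fun k => ?_⟩
  have hp := (p.pos k).le
  calc p k * ‖(p k : ℂ) * f.coeff k * g.coeff k‖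
      = (p k * ‖f.coeff k‖) * (p k * ‖g.coeff k‖) := by
        rw [norm_mul, norm_mul, Complex.norm_real, Real.norm_of_nonneg hp]; ring
    _ ≤ C * D := mul_le_mul (hC k) (hD k) (by positivity) ((by positivity : (0 : ℝ) ≤ _).trans (hC k))

/-- The weighted Hadamard product `(f * g)(z) = ∑ p(k) f̂(k) ĝ(k) zᵏ`. -/
instance : Mul (EntireAlg p) :=
  ⟨fun f g => ofCoeff (fun k => (p k : ℂ) * f.coeff k * g.coeff k) (mul_bound f g)⟩

/-- The unit element `ε(z) = ∑ p(k)⁻¹ zᵏ`. -/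
instance : One (EntireAlg p) :=
  ⟨ofCoeff (fun k => ((p k : ℂ))⁻¹) ⟨1, fun k => by
    rw [norm_inv, Complex.norm_real, Real.norm_of_nonneg (p.pos k).le,
      mul_inv_cancel₀ (p.pos k).ne']⟩⟩

theorem coeff_mul (f g : EntireAlg p) (k : ℕ) :
    (f * g).coeff k = (p k : ℂ) * f.coeff k * g.coeff k := coeff_ofCoeff _ _ k

theorem coeff_one (k : ℕ) : (1 : EntireAlg p).coeff k = ((p k : ℂ))⁻¹ := coeff_ofCoeff _ _ k

theorem weight_ne_zero (p : Weight) (k : ℕ) : (p k : ℂ) ≠ 0 := by exact_mod_cast (p.pos k).ne'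

instance : CommRing (EntireAlg p) :=
  { (inferInstance : AddCommGroup (EntireAlg p)),
    (inferInstance : Mul (EntireAlg p)), (inferInstance : One (EntireAlg p)) with
    mul_assoc := fun f g h => ext_coeff fun k => by simp only [coeff_mul]; ring
    mul_comm := fun f g => ext_coeff fun k => by simp only [coeff_mul]; ring
    one_mul := fun f => ext_coeff fun k => by
      rw [coeff_mul, coeff_one, mul_inv_cancel₀ (weight_ne_zero p k), one_mul]
    mul_one := fun f => ext_coeff fun k => by
      rw [coeff_mul, coeff_one, mul_right_comm, mul_inv_cancel₀ (weight_ne_zero p k), one_mul]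
    left_distrib := fun f g h => ext_coeff fun k => by simp only [coeff_mul, coeff_add]; ring
    right_distrib := fun f g h => ext_coeff fun k => by simp only [coeff_mul, coeff_add]; ring
    zero_mul := fun f => ext_coeff fun k => by simp only [coeff_mul, coeff_zero]; ring
    mul_zero := fun f => ext_coeff fun k => by simp only [coeff_mul, coeff_zero]; ring }

instance : Algebra ℂ (EntireAlg p) :=
  Algebra.ofModule
    (fun c f g => ext_coeff fun k => by simp only [coeff_mul, coeff_smul]; ring)
    (fun c f g => ext_coeff fun k => by simp only [coeff_mul, coeff_smul]; ring)

/-- The norm `‖f‖ = sup_k p(k) |f̂(k)|`. -/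
instance : Norm (EntireAlg p) := ⟨fun f => ⨆ k, p k * ‖f.coeff k‖⟩

theorem norm_def (f : EntireAlg p) : ‖f‖ = ⨆ k, p k * ‖f.coeff k‖ := rfl

theorem le_norm (f : EntireAlg p) (k : ℕ) : p k * ‖f.coeff k‖ ≤ ‖f‖ := by
  obtain ⟨C, hC⟩ := f.exists_bound
  exact le_ciSup (f := fun k => p k * ‖f.coeff k‖) ⟨C, by rintro _ ⟨k, rfl⟩; exact hC k⟩ k

theorem norm_le_of {f : EntireAlg p} {C : ℝ} (h : ∀ k, p k * ‖f.coeff k‖ ≤ C) : ‖f‖ ≤ C :=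
  ciSup_le h

theorem norm_nonneg' (f : EntireAlg p) : 0 ≤ ‖f‖ :=
  (mul_nonneg (p.pos 0).le (norm_nonneg _)).trans (f.le_norm 0)

instance : NormedAddCommGroup (EntireAlg p) :=
  AddGroupNorm.toNormedAddCommGroup
    { toFun := fun f => ‖f‖
      map_zero' := le_antisymm (norm_le_of fun k => by simp [coeff_zero]) (norm_nonneg' _)
      add_le' := fun f g => norm_le_of fun k => by
        have h := mul_le_mul_of_nonneg_left (norm_add_le (f.coeff k) (g.coeff k)) (p.pos k).le
        have := f.le_norm k
        have := g.le_norm k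
        rw [coeff_add]
        linarith
      neg' := fun f => by simp only [norm_def, coeff_neg, norm_neg]
      eq_zero_of_map_eq_zero' := fun f hf => ext_coeff fun k => by
        have h1 : p k * ‖f.coeff k‖ ≤ 0 := (f.le_norm k).trans_eq hf
        have h2 : ‖f.coeff k‖ ≤ 0 := nonpos_of_mul_nonpos_right h1 (p.pos k)
        rw [coeff_zero, norm_le_zero_iff.mp h2] }

instance : NormedCommRing (EntireAlg p) :=
  { (inferInstance : NormedAddCommGroup (EntireAlg p)),
    (inferInstance : CommRing (EntireAlg p)) with
    norm_mul_le := fun f g => norm_le_of fun k => by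
      have hp := (p.pos k).le
      calc p k * ‖(f * g).coeff k‖ = (p k * ‖f.coeff k‖) * (p k * ‖g.coeff k‖) := by
            rw [coeff_mul, norm_mul, norm_mul, Complex.norm_real, Real.norm_of_nonneg hp]; ring
        _ ≤ ‖f‖ * ‖g‖ := mul_le_mul (f.le_norm k) (g.le_norm k) (by positivity) (norm_nonneg' f) }

instance : NormOneClass (EntireAlg p) where
  norm_one := by
    have h : ∀ k, p k * ‖(1 : EntireAlg p).coeff k‖ = 1 := fun k => by
      rw [coeff_one, norm_inv, Complex.norm_real, Real.norm_of_nonneg (p.pos k).le,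
        mul_inv_cancel₀ (p.pos k).ne']
    rw [norm_def]
    simp only [h, ciSup_const]

instance : NormedAlgebra ℂ (EntireAlg p) where
  norm_smul_le c f := norm_le_of fun k => by
    have h := mul_le_mul_of_nonneg_left (f.le_norm k) (norm_nonneg c)
    rw [coeff_smul, norm_mul]
    linarith

/-- `𝒜(p)` is complete, so it is a Banach algebra. -/
instance : CompleteSpace (EntireAlg p) := by
  have hb : ∀ a : lp (fun _ : ℕ => ℂ) ∞, ∀ k, p k * ‖((p k : ℂ))⁻¹ * a k‖ ≤ ‖a‖ := fun a k => by
    rw [norm_mul, norm_inv, Complex.norm_real, Real.norm_of_nonneg (p.pos k).le,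
      mul_inv_cancel_left₀ (p.pos k).ne']
    exact lp.norm_apply_le_norm ENNReal.top_ne_zero a k
  let e : lp (fun _ : ℕ => ℂ) ∞ → EntireAlg p := fun a =>
    ofCoeff (fun k => ((p k : ℂ))⁻¹ * a k) ⟨‖a‖, hb a⟩
  have hsub : ∀ a b, e a - e b = e (a - b) := fun a b => ext_coeff fun k => by
    simp only [e, sub_eq_add_neg, coeff_add, coeff_neg, coeff_ofCoeff]
    simp [mul_add]
  have hiso : Isometry e := Isometry.of_dist_eq fun a b => by
    rw [dist_eq_norm, dist_eq_norm, hsub, norm_def, lp.norm_eq_ciSup]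
    refine iSup_congr fun k => ?_
    simp only [e, coeff_ofCoeff]
    rw [norm_mul, norm_inv, Complex.norm_real, Real.norm_of_nonneg (p.pos k).le,
      mul_inv_cancel_left₀ (p.pos k).ne']
  have hsurj : Function.Surjective e := fun f => by
    obtain ⟨C, hC⟩ := f.exists_bound
    refine ⟨⟨fun k => (p k : ℂ) * f.coeff k, memℓp_infty ⟨C, ?_⟩⟩, ext_coeff fun k => ?_⟩
    · rintro _ ⟨k, rfl⟩
      simpa [abs_of_pos (p.pos k)] using hC k
    · simp only [e, coeff_ofCoeff]
      rw [inv_mul_cancel_left₀ (weight_ne_zero p k)]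
  exact (IsometryEquiv.mk (Equiv.ofBijective e ⟨hiso.injective, hsurj⟩) hiso).completeSpace_iff.mp
    inferInstance

end EntireAlg

end WeightedHadamard

end

/-!
Evaluating `f ↦ p(k) f̂(k)` identifies `𝒜(p)` with the bounded sequences: these characters
separate points, every bounded sequence of values occurs, and an element is invertible exactly when
its values are bounded away from `0` (`EntireAlg.isUnit_iff`). So a matrix over `𝒜(p)` is a bounded
sequence of complex matrices `Aₖ`, and an invertible one has `|det Aₖ|` bounded away from `0`.

In a Banach algebra, `x` is an exponential as soon as the whole segment from `1` to `x` consists of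
units (`exists_exp_eq_of_isUnit_segment`): inside the double centralizer of `x`, which is a
commutative Banach algebra with the same units, the exponentials form an open, hence closed,
subgroup of the units, and the segment connects `x` to `1`.

This is applied to `u • A` for a suitable scalar `u = exp g` in `𝒜(p)`. The segment from `1` to
`u • A` may meet singular matrices, or come arbitrarily close to them, only when an eigenvalue of
some `uₖ Aₖ` is near the negative real axis. Among `n + 1` fixed rotations, the pigeonhole
principle provides for each `k` one that keeps the `n` eigenvalues of `Aₖ` away from that axis, by
an angle depending on `n` alone (`exists_rotation`). This bounds the determinants along the
segment away from `0`, uniformly in `k` (`le_norm_sq_det`), so `u • A = exp B` for some `B`. The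
angles of the rotations being bounded, `g` does belong to `𝒜(p)`, and it is central, so
`A = exp (B - g)`.
-/

/-! ### Exponentials in Banach algebras -/

/-- In a commutative complex Banach algebra, every unit that is joined to `1` by a path of units is
an exponential, because the exponentials form a clopen subgroup of the group of units. -/
theorem exists_exp_eq_of_path {𝔸 : Type*} [NormedCommRing 𝔸] [NormedAlgebra ℂ 𝔸] [CompleteSpace 𝔸]
    {γ : ℝ → 𝔸} (hγ : Continuous γ) (hu : ∀ t ∈ Set.Icc (0 : ℝ) 1, IsUnit (γ t)) (h0 : γ 0 = 1) :
    ∃ b, NormedSpace.exp b = γ 1 := by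
  let +nondep : NormedAlgebra ℚ 𝔸 := .restrictScalars ℚ ℂ 𝔸
  let e : Multiplicative 𝔸 →* 𝔸ˣ := MonoidHom.toHomUnits
    { toFun := fun x => NormedSpace.exp x.toAdd
      map_one' := by simp
      map_mul' := fun x y => by simpa using NormedSpace.exp_add_of_commute (Commute.all _ _) }
  have hopen : IsOpen (e.range : Set 𝔸ˣ) := by
    refine Subgroup.isOpen_of_mem_nhds _ (g := 1) ?_
    -- The derivative of `exp` at `0` is the identity, so `exp` maps neighbourhoods of `0` onto
    -- neighbourhoods of `1`.
    have h1 : Set.range (NormedSpace.exp : 𝔸 → 𝔸) ∈ 𝓝 (1 : 𝔸) := by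
      have h := (hasStrictFDerivAt_exp_zero (𝕂 := ℂ) (𝔸 := 𝔸)).map_nhds_eq_of_equiv
        (f' := ContinuousLinearEquiv.refl ℂ 𝔸)
      rw [NormedSpace.exp_zero] at h
      rw [← h]
      exact range_mem_map
    have h2 : (Units.val : 𝔸ˣ → 𝔸) ⁻¹' Set.range (NormedSpace.exp : 𝔸 → 𝔸) ∈ 𝓝 (1 : 𝔸ˣ) :=
      Units.continuous_val.continuousAt.preimage_mem_nhds (by simpa using h1)
    filter_upwards [h2]
    rintro u ⟨b, hb⟩
    exact ⟨Multiplicative.ofAdd b, Units.ext hb⟩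
  let g : Set.Icc (0 : ℝ) 1 → 𝔸ˣ := fun t => (hu t t.2).unit
  have hg : Continuous g := by
    rw [Units.isOpenEmbedding_val.isEmbedding.continuous_iff]
    exact hγ.comp continuous_subtype_val
  have hclopen : IsClopen (g ⁻¹' (e.range : Set 𝔸ˣ)) :=
    IsClopen.preimage ⟨Subgroup.isClosed_of_isOpen _ hopen, hopen⟩ hg
  have huniv := hclopen.eq_univ ⟨⟨0, by simp⟩, 1, by ext; simp [g, h0]⟩
  have h1 : (⟨1, by simp⟩ : Set.Icc (0 : ℝ) 1) ∈ g ⁻¹' (e.range : Set 𝔸ˣ) := huniv ▸ Set.mem_univ _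
  obtain ⟨b, hb⟩ := h1
  exact ⟨b.toAdd, congrArg Units.val hb⟩

/-- An element of a complex Banach algebra is an exponential if the segment joining it to `1`
consists of units. The logarithm is found in the double centralizer of the element, which is
commutative, closed, and contains the inverses of its elements. -/
theorem exists_exp_eq_of_isUnit_segment {𝔸 : Type*} [NormedRing 𝔸] [NormedAlgebra ℂ 𝔸]
    [CompleteSpace 𝔸] {x : 𝔸}
    (hu : ∀ t ∈ Set.Icc (0 : ℝ) 1, IsUnit (((1 - t : ℝ) : ℂ) • (1 : 𝔸) + (t : ℂ) • x)) :
    ∃ b, NormedSpace.exp b = x := by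
  let +nondep : NormedAlgebra ℚ 𝔸 := .restrictScalars ℚ ℂ 𝔸
  let S := Subalgebra.centralizer ℂ (Set.centralizer {x} : Set 𝔸)
  have hcomm : ∀ a b : S, a * b = b * a := fun a b => Subtype.ext <|
    Set.centralizer_centralizer_comm_of_comm (S := {x}) (by simp) _ a.2 _ b.2
  let : NormedCommRing S := { (inferInstance : NormedRing S) with mul_comm := hcomm }
  have : CompleteSpace S := (Set.isClosed_centralizer _).completeSpace_coe
  let +nondep : NormedAlgebra ℚ S := .restrictScalars ℚ ℂ S
  let y : S := ⟨x, Set.subset_centralizer_centralizer rfl⟩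
  obtain ⟨b, hb⟩ := exists_exp_eq_of_path (𝔸 := S)
    (γ := fun t => ((1 - t : ℝ) : ℂ) • (1 : S) + (t : ℂ) • y) (by fun_prop) (fun t ht => by
      obtain ⟨v, hv⟩ := hu t ht
      set z : S := ((1 - t : ℝ) : ℂ) • (1 : S) + (t : ℂ) • y with hz
      have hvz : (v : 𝔸) = z := hv
      have hinv : ((v⁻¹ : 𝔸ˣ) : 𝔸) ∈ S := by
        rw [Subalgebra.mem_centralizer_iff]
        intro c hc
        have h1 : Commute c v := by rw [hvz]; exact (Subalgebra.mem_centralizer_iff ℂ).1 z.2 c hc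
        exact h1.units_inv_right
      exact IsUnit.of_mul_eq_one ⟨_, hinv⟩ (Subtype.ext (by simp [← hvz]))) (by simp)
  refine ⟨b, ?_⟩
  have h := NormedSpace.map_exp S.val continuous_subtype_val b
  rw [hb] at h
  simpa [y] using h.symm


/-! ### Rotating eigenvalues away from the negative real axis -/

theorem det_smul_one_add_smul {n : Type*} [Fintype n] [DecidableEq n] (A : Matrix n n ℂ) (a b : ℂ) :
    (a • (1 : Matrix n n ℂ) + b • A).det = (A.charpoly.roots.map fun z => a + b * z).prod := by
  have hs := IsAlgClosed.splits A.charpoly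
  have hcard : A.charpoly.roots.card = Fintype.card n := by
    rw [← hs.natDegree_eq_card_roots, A.charpoly_natDegree_eq_dim]
  rcases eq_or_ne b 0 with rfl | hb
  · simp [hcard]
  have h1 : a • (1 : Matrix n n ℂ) + b • A = (-b) • (Matrix.scalar n (-(a / b)) - A) := by
    ext i j
    simp only [Matrix.add_apply, Matrix.smul_apply, Matrix.sub_apply, Matrix.scalar_apply,
      Matrix.one_apply, Matrix.diagonal_apply, smul_eq_mul]
    split_ifs <;> field_simp <;> ring
  have h2 : A.charpoly.eval (-(a / b)) = (A.charpoly.roots.map fun z => -(a / b) - z).prod := by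
    conv_lhs => rw [hs.eq_prod_roots_of_monic A.charpoly_monic]
    simp [Polynomial.eval_multiset_prod, Multiset.map_map]
  rw [h1, Matrix.det_smul, ← Matrix.eval_charpoly, ← hcard, h2, ← Multiset.prod_replicate,
    ← Multiset.map_const', ← Multiset.prod_map_mul]
  refine congrArg Multiset.prod (Multiset.map_congr rfl fun z _ => ?_)
  simp
  field_simp
  ring

/-- If the direction of `w` is at distance at least `η / 2` from `-1`, there is little cancellation
in `a + b w` for nonnegative `a` and `b`. -/
theorem le_norm_sq_add_mul {κ η a b : ℝ} {w : ℂ} (hκ : κ ≤ 1) (hκη : 8 * κ ≤ η ^ 2)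
    (hη : 0 ≤ η) (ha : 0 ≤ a) (hb : 0 ≤ b) (hw : η / 2 * ‖w‖ ≤ ‖w + ‖w‖‖) :
    κ * (a ^ 2 + b ^ 2 * ‖w‖ ^ 2) ≤ ‖a + b * w‖ ^ 2 := by
  have hr := norm_nonneg w
  have hre : -(1 - κ) * ‖w‖ ≤ w.re := by
    rcases hr.eq_or_lt with h0 | h0
    · rw [norm_eq_zero.1 h0.symm]; simp
    · have h1 : (η / 2 * ‖w‖) ^ 2 ≤ ‖w + ‖w‖‖ ^ 2 := by gcongr
      have h2 : ‖w + ‖w‖‖ ^ 2 = 2 * ‖w‖ * (‖w‖ + w.re) := by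
        have h3 : ‖w‖ ^ 2 = w.re * w.re + w.im * w.im := by
          rw [Complex.sq_norm, Complex.normSq_apply]
        rw [Complex.sq_norm, Complex.normSq_apply]
        simp
        linarith
      rw [h2] at h1
      have h3 : ‖w‖ * (η ^ 2 / 8 * ‖w‖) ≤ ‖w‖ * (‖w‖ + w.re) := by linarith
      have h4 := le_of_mul_le_mul_left h3 h0
      nlinarith
  have h5 : ‖a + b * w‖ ^ 2 = a ^ 2 + b ^ 2 * ‖w‖ ^ 2 + 2 * (a * b) * w.re := by
    simp only [Complex.sq_norm, Complex.normSq_apply]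
    simp
    ring
  have h6 := mul_le_mul_of_nonneg_left hre (mul_nonneg ha hb)
  have h7 := mul_nonneg (sub_nonneg.2 hκ) (sq_nonneg (a - b * ‖w‖))
  rw [h5]
  linarith

/-- Any `n` complex numbers can be rotated simultaneously, by an angle in `[0, 1]`, so that
nonnegative combinations of `1` and a rotated number have a lower bound depending only on `n`. Of
`n + 1` distinct rotations, each number spoils at most one. -/
theorem exists_rotation (n : ℕ) : ∃ κ : ℝ, 0 < κ ∧ ∀ s : Multiset ℂ, s.card = n →
    ∃ θ ∈ Set.Icc (0 : ℝ) 1, ∀ z ∈ s, ∀ a b : ℝ, 0 ≤ a → 0 ≤ b →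
      κ * (a ^ 2 + b ^ 2 * ‖z‖ ^ 2) ≤ ‖a + b * (Complex.exp (θ * Complex.I) * z)‖ ^ 2 := by
  let θ : Fin (n + 1) → ℝ := fun m => m / (n + 1)
  have hθ : ∀ m, θ m ∈ Set.Icc (0 : ℝ) 1 := fun m => by
    refine ⟨by positivity, (div_le_one (by positivity)).2 ?_⟩
    exact_mod_cast m.2.le
  let u : Fin (n + 1) → ℂ := fun m => Complex.exp (θ m * Complex.I)
  have hu : ∀ m, ‖u m‖ = 1 := fun m => Complex.norm_exp_ofReal_mul_I _
  have hinj : Function.Injective u := fun m m' h => by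
    have hpi := Real.pi_gt_three
    have h1 : ∀ m, (θ m * Complex.I).im = θ m := fun m => by simp
    have h2 := Complex.exp_inj_of_neg_pi_lt_of_le_pi (x := θ m * Complex.I) (y := θ m' * Complex.I)
      (by rw [h1]; linarith [(hθ m).1]) (by rw [h1]; linarith [(hθ m).2])
      (by rw [h1]; linarith [(hθ m').1]) (by rw [h1]; linarith [(hθ m').2]) h
    have h3 : θ m = θ m' := by simpa using h2
    have hn : (n : ℝ) + 1 ≠ 0 := by positivity
    have h4 : (m : ℝ) = m' := by simpa [θ, div_left_inj' hn] using h3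
    exact Fin.ext (by exact_mod_cast h4)
  obtain ⟨η, hη0, hη⟩ : ∃ η : ℝ, 0 < η ∧ ∀ i j, i ≠ j → η ≤ ‖u i - u j‖ := by
    have h : ∀ᶠ η : ℝ in 𝓝[>] 0, ∀ i j, i ≠ j → η ≤ ‖u i - u j‖ := by
      simp only [eventually_all]
      intro i j hij
      exact eventually_nhdsWithin_of_eventually_nhds <|
        eventually_le_nhds (norm_pos_iff.2 (sub_ne_zero.2 (hinj.ne hij)))
    obtain ⟨η, h1, h2⟩ := (h.and self_mem_nhdsWithin).exists
    exact ⟨η, h2, h1⟩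
  refine ⟨min 1 (η ^ 2 / 8), by positivity, fun s hs => ?_⟩
  by_contra! hbad
  have hclose : ∀ m, ∃ z ∈ s, ‖u m * z + ‖z‖‖ < η / 2 * ‖z‖ := fun m => by
    obtain ⟨z, hz, a, b, ha, hb, hlt⟩ := hbad (θ m) (hθ m)
    refine ⟨z, hz, ?_⟩
    by_contra! hle
    have hn : ‖u m * z‖ = ‖z‖ := by rw [norm_mul, hu, one_mul]
    rw [← hn] at hle hlt
    exact hlt.not_ge (le_norm_sq_add_mul (min_le_left _ _)
      (by linarith [min_le_right 1 (η ^ 2 / 8)]) hη0.le ha hb hle)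
  choose f hf hfs using hclose
  obtain ⟨i, -, j, -, hij, hfij⟩ := Finset.exists_ne_map_eq_of_card_lt_of_maps_to
    (s := Finset.univ) (t := s.toFinset) (f := f)
    (by simpa using Nat.lt_succ_of_le (hs ▸ s.toFinset_card_le))
    (fun m _ => by simpa using hf m)
  have h1 := hfs i
  have h2 := hfs j
  rw [← hfij] at h2
  have h3 : ‖u i - u j‖ * ‖f i‖ ≤ ‖u i * f i + ‖f i‖‖ + ‖u j * f i + ‖f i‖‖ := by
    rw [← norm_mul, sub_mul, ← add_sub_add_right_eq_sub _ _ (‖f i‖ : ℂ)]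
    exact norm_sub_le _ _
  have h4 := mul_le_mul_of_nonneg_right (hη i j hij) (norm_nonneg (f i))
  linarith

/-- A lower bound for the determinants on the segment from `1` to `u • A` that depends on `A` only
through the size of the matrix and a lower bound for `|det A|`. -/
theorem le_norm_sq_det {n : Type*} [Fintype n] [DecidableEq n] {A : Matrix n n ℂ} {κ d t : ℝ}
    {u : ℂ} (hκ : 0 ≤ κ) (hd : 0 ≤ d) (hdet : d ≤ ‖A.det‖) (ht : t ∈ Set.Icc (0 : ℝ) 1)
    (hA : ∀ z ∈ A.charpoly.roots, ∀ a b : ℝ, 0 ≤ a → 0 ≤ b →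
      κ * (a ^ 2 + b ^ 2 * ‖z‖ ^ 2) ≤ ‖a + b * (u * z)‖ ^ 2) :
    (κ / 4) ^ Fintype.card n * min 1 (d ^ 2) ≤
      ‖(((1 - t : ℝ) : ℂ) • (1 : Matrix n n ℂ) + (t : ℂ) • (u • A)).det‖ ^ 2 := by
  have hcard : A.charpoly.roots.card = Fintype.card n := by
    rw [← (IsAlgClosed.splits A.charpoly).natDegree_eq_card_roots, A.charpoly_natDegree_eq_dim]
  have hkey : ∀ g : ℂ → ℝ, (∀ z, 0 ≤ g z) →
      (∀ z, g z ≤ 4 * ((1 - t) ^ 2 + t ^ 2 * ‖z‖ ^ 2)) →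
      (κ / 4) ^ Fintype.card n * (A.charpoly.roots.map g).prod ≤
      ‖(((1 - t : ℝ) : ℂ) • (1 : Matrix n n ℂ) + (t : ℂ) • (u • A)).det‖ ^ 2 := by
    intro g hg0 hg
    rw [smul_smul, det_smul_one_add_smul, ← hcard, ← normHom_apply, map_multiset_prod,
      Multiset.map_map, ← Multiset.prod_map_pow, ← Multiset.prod_replicate, ← Multiset.map_const',
      ← Multiset.prod_map_mul]
    refine Multiset.prod_map_le_prod_map₀ _ _ (fun z _ => mul_nonneg (by positivity) (hg0 z))
      fun z hz => ?_
    calc κ / 4 * g z ≤ κ / 4 * (4 * ((1 - t) ^ 2 + t ^ 2 * ‖z‖ ^ 2)) := by gcongr; exact hg z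
      _ = κ * ((1 - t) ^ 2 + t ^ 2 * ‖z‖ ^ 2) := by ring
      _ ≤ _ := by simpa [mul_assoc] using hA z hz (1 - t) t (by linarith [ht.2]) ht.1
  have hc : 0 ≤ (κ / 4) ^ Fintype.card n := by positivity
  -- On the first half of the segment the summand `1 - t` dominates; on the second half the
  -- eigenvalues do, and their product is `det A`.
  rcases le_total t (1 / 2) with h | h
  · refine le_trans (mul_le_mul_of_nonneg_left (min_le_left _ _) hc) ?_
    have h1 := hkey (fun _ => 1) (fun _ => zero_le_one) fun z => by
      have : 0 ≤ t ^ 2 * ‖z‖ ^ 2 := by positivity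
      nlinarith
    simpa using h1
  · refine le_trans (mul_le_mul_of_nonneg_left ((min_le_right _ _).trans
      (pow_le_pow_left₀ hd hdet 2)) hc) ?_
    have h1 := hkey (fun z => ‖z‖ ^ 2) (fun _ => by positivity) fun z => by
      have : 0 ≤ ‖z‖ ^ 2 := by positivity
      have : 1 ≤ 4 * t ^ 2 := by nlinarith
      nlinarith [sq_nonneg (1 - t)]
    rwa [Multiset.prod_map_pow, A.det_eq_prod_roots_charpoly, ← normHom_apply,
      map_multiset_prod] at *

/-- The case of a matrix algebra. The exponential there is taken for the product topology, which is
that of the operator norm. -/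
theorem Matrix.exists_exp_eq_of_isUnit_segment {n 𝔸 : Type*} [Fintype n] [DecidableEq n]
    [NormedRing 𝔸] [NormedAlgebra ℂ 𝔸] [CompleteSpace 𝔸] {A : Matrix n n 𝔸}
    (hu : ∀ t ∈ Set.Icc (0 : ℝ) 1,
      IsUnit (((1 - t : ℝ) : ℂ) • (1 : Matrix n n 𝔸) + (t : ℂ) • A)) :
    ∃ B, NormedSpace.exp B = A := by
  open scoped Matrix.Norms.Operator in
  have h1 : Matrix.instUniformSpace n n 𝔸 =
    PseudoMetricSpace.toUniformSpace := rfl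
  have h2 : @CompleteSpace (Matrix n n 𝔸) PseudoMetricSpace.toUniformSpace :=
    h1 ▸ inferInstance
  convert _root_.exists_exp_eq_of_isUnit_segment hu <;> rfl

/-! ### The characters of the algebra of entire functions -/

namespace WeightedHadamard.EntireAlg

variable {p : Weight}

/-- The character `f ↦ p(k) f̂(k)` of `𝒜(p)`. The factor `p(k)` turns the weighted Hadamard product
into multiplication of numbers. -/
noncomputable def weightedCoeff (p : Weight) (k : ℕ) : EntireAlg p →+* ℂ where
  toFun f := (p k : ℂ) * f.coeff k
  map_zero' := by rw [coeff_zero, mul_zero]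
  map_one' := by rw [coeff_one, mul_inv_cancel₀ (weight_ne_zero p k)]
  map_add' f g := by rw [coeff_add, mul_add]
  map_mul' f g := by rw [coeff_mul]; ring

theorem weightedCoeff_apply (k : ℕ) (f : EntireAlg p) :
    weightedCoeff p k f = (p k : ℂ) * f.coeff k := rfl

theorem weightedCoeff_smul (k : ℕ) (c : ℂ) (f : EntireAlg p) :
    weightedCoeff p k (c • f) = c * weightedCoeff p k f := by
  simp only [weightedCoeff_apply, coeff_smul]; ring

theorem norm_weightedCoeff_le (k : ℕ) (f : EntireAlg p) : ‖weightedCoeff p k f‖ ≤ ‖f‖ := by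
  rw [weightedCoeff_apply, norm_mul, Complex.norm_real, Real.norm_of_nonneg (p.pos k).le]
  exact f.le_norm k

theorem continuous_weightedCoeff (k : ℕ) : Continuous (weightedCoeff p k) :=
  AddMonoidHomClass.continuous_of_bound (weightedCoeff p k) 1 fun f => by
    simpa using norm_weightedCoeff_le k f

theorem exists_weightedCoeff_eq {a : ℕ → ℂ} {C : ℝ} (h : ∀ k, ‖a k‖ ≤ C) :
    ∃ f : EntireAlg p, ∀ k, weightedCoeff p k f = a k := by
  refine ⟨ofCoeff (fun k => ((p k : ℂ))⁻¹ * a k) ⟨C, fun k => ?_⟩, fun k => ?_⟩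
  · rw [norm_mul, norm_inv, Complex.norm_real, Real.norm_of_nonneg (p.pos k).le,
      mul_inv_cancel_left₀ (p.pos k).ne']
    exact h k
  · rw [weightedCoeff_apply, coeff_ofCoeff, mul_inv_cancel_left₀ (weight_ne_zero p k)]

theorem ext_weightedCoeff {f g : EntireAlg p} (h : ∀ k, weightedCoeff p k f = weightedCoeff p k g) :
    f = g :=
  ext_coeff fun k => mul_left_cancel₀ (weight_ne_zero p k) (h k)

theorem isUnit_iff {f : EntireAlg p} :
    IsUnit f ↔ ∃ c > 0, ∀ k, c ≤ ‖weightedCoeff p k f‖ := by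
  constructor
  · rintro ⟨u, rfl⟩
    have hu : 0 < ‖((u⁻¹ : (EntireAlg p)ˣ) : EntireAlg p)‖ + 1 := by positivity
    refine ⟨(‖((u⁻¹ : (EntireAlg p)ˣ) : EntireAlg p)‖ + 1)⁻¹, inv_pos.2 hu, fun k => ?_⟩
    rw [inv_le_iff_one_le_mul₀ hu]
    have h1 := norm_weightedCoeff_le k ((u⁻¹ : (EntireAlg p)ˣ) : EntireAlg p)
    have h2 : weightedCoeff p k u * weightedCoeff p k ((u⁻¹ : (EntireAlg p)ˣ) : EntireAlg p) = 1 := by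
      rw [← map_mul, Units.mul_inv, map_one]
    calc (1 : ℝ) = ‖weightedCoeff p k u‖ *
          ‖weightedCoeff p k ((u⁻¹ : (EntireAlg p)ˣ) : EntireAlg p)‖ := by
            rw [← norm_mul, h2, norm_one]
      _ ≤ _ := by gcongr; linarith
  · rintro ⟨c, hc, h⟩
    obtain ⟨g, hg⟩ := exists_weightedCoeff_eq (p := p) (a := fun k => (weightedCoeff p k f)⁻¹)
      (C := c⁻¹) fun k => by rw [norm_inv]; exact inv_anti₀ hc (h k)
    refine IsUnit.of_mul_eq_one g (ext_weightedCoeff fun k => ?_)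
    rw [map_mul, hg, map_one, mul_inv_cancel₀ (norm_pos_iff.1 (hc.trans_le (h k)))]

theorem weightedCoeff_exp (k : ℕ) (f : EntireAlg p) :
    weightedCoeff p k (NormedSpace.exp f) = Complex.exp (weightedCoeff p k f) := by
  let +nondep : NormedAlgebra ℚ (EntireAlg p) := .restrictScalars ℚ ℂ _
  rw [NormedSpace.map_exp _ (continuous_weightedCoeff k), Complex.exp_eq_exp_ℂ]

end WeightedHadamard.EntireAlg

/-! ### Logarithms of invertible matrices -/

open WeightedHadamard EntireAlg in
theorem mainTheorem11 (p : WeightedHadamard.Weight) (n : ℕ)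
    (A : Matrix.GeneralLinearGroup (Fin n) (WeightedHadamard.EntireAlg p)) :
    ∃ B : Matrix (Fin n) (Fin n) (WeightedHadamard.EntireAlg p),
      NormedSpace.exp B = (A : Matrix (Fin n) (Fin n) (WeightedHadamard.EntireAlg p)) := by
  let +nondep : NormedAlgebra ℚ (EntireAlg p) := .restrictScalars ℚ ℂ _
  set M : Matrix (Fin n) (Fin n) (EntireAlg p) := A.val
  obtain ⟨d, hd, hdet⟩ := isUnit_iff.1 ((Matrix.isUnit_iff_isUnit_det M).1 A.isUnit)
  obtain ⟨κ, hκ, hrot⟩ := exists_rotation n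
  let N : ℕ → Matrix (Fin n) (Fin n) ℂ := fun k => (weightedCoeff p k).mapMatrix M
  have hN : ∀ k, (N k).charpoly.roots.card = n := fun k => by
    rw [← (IsAlgClosed.splits _).natDegree_eq_card_roots, (N k).charpoly_natDegree_eq_dim,
      Fintype.card_fin]
  -- The rotation for the index `k` is chosen for the eigenvalues of the `k`-th matrix `N k`.
  choose θ hθ hθN using fun k => hrot _ (hN k)
  obtain ⟨g, hg⟩ := exists_weightedCoeff_eq (p := p) (a := fun k => θ k * Complex.I) (C := 1)
    fun k => by simpa [abs_of_nonneg (hθ k).1] using (hθ k).2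
  have hseg : ∀ t ∈ Set.Icc (0 : ℝ) 1, IsUnit (((1 - t : ℝ) : ℂ) •
      (1 : Matrix (Fin n) (Fin n) (EntireAlg p)) + (t : ℂ) • (NormedSpace.exp g • M)) := by
    intro t ht
    rw [Matrix.isUnit_iff_isUnit_det, isUnit_iff]
    have hc : 0 < (κ / 4) ^ n * min 1 (d ^ 2) := by positivity
    refine ⟨√((κ / 4) ^ n * min 1 (d ^ 2)), Real.sqrt_pos.2 hc, fun k => ?_⟩
    rw [Real.sqrt_le_left (norm_nonneg _), RingHom.map_det]
    have h1 := le_norm_sq_det hκ.le hd.le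
      (by simpa only [N, ← RingHom.map_det] using hdet k) ht (hθN k)
    rw [Fintype.card_fin] at h1
    have hmap : (weightedCoeff p k).mapMatrix (((1 - t : ℝ) : ℂ) •
        (1 : Matrix (Fin n) (Fin n) (EntireAlg p)) + (t : ℂ) • (NormedSpace.exp g • M)) =
        ((1 - t : ℝ) : ℂ) • (1 : Matrix (Fin n) (Fin n) ℂ) +
          (t : ℂ) • (Complex.exp (θ k * Complex.I) • N k) := by
      ext1 i j
      simp [-Complex.coe_smul, N, weightedCoeff_smul, weightedCoeff_exp, hg, Matrix.one_apply,
        apply_ite (weightedCoeff p k)]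
    rwa [hmap]
  obtain ⟨B, hB⟩ := Matrix.exists_exp_eq_of_isUnit_segment hseg
  -- The scalar matrix with entry `-g` commutes with `B`, and its exponential undoes the rotation.
  refine ⟨B + Matrix.scalar (Fin n) (-g), ?_⟩
  rw [Matrix.exp_add_of_commute _ _ (Matrix.scalar_commute _ (fun _ => Commute.all _ _) _).symm, hB,
    Matrix.scalar_apply, Matrix.exp_diagonal]
  have h1 : NormedSpace.exp (fun _ : Fin n => -g) = fun _ => NormedSpace.exp (-g) := by
    ext1 i
    exact Pi.coe_exp _ i
  have h2 : NormedSpace.exp g * NormedSpace.exp (-g) = 1 := by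
    rw [← NormedSpace.exp_add_of_commute (Commute.all _ _), add_neg_cancel, NormedSpace.exp_zero]
  ext1 i j
  rw [h1, Matrix.mul_diagonal, Matrix.smul_apply, smul_eq_mul, mul_right_comm, h2, one_mul]
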